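/- Let $E,F\in\mathbb C^{n\times m}$, consider the matrix pencil $P(s)=sE-F$, and let $\lambda\in\mathbb C\cup\{\infty\}$. The following conditions are equivalent: (a) $\lambda$ is an eigenvalue of $P(s)$; (b) $\lambda$ is a proper eigenvalue of the linear relation $E^{-1}F:=\{(x,y)\in\mathbb C^m\times\mathbb C^m : Fx=Ey\}$ in $\mathbb C^m$ (the kernel representation of $P$); (c) $\lambda$ is a proper eigenvalue of the linear relation $FE^{-1}:=\{(Ex,Fx) : x\in\mathbb C^m\}$ in $\mathbb C^n$ (the range representation of $P$). Here the following definitions are used. The normal rank of $P$ is the largest $k\ge 0$ such that $P(s)$ has a $k\times k$ submatrix whose determinant is not zero for all $s\in\mathbb C$ (with $k=0$ always admitted). A number $\lambda\in\mathbb C$ is an eigenvalue of $P$ if $\operatorname{rank}P(\lambda)$ is less than the normal rank of $P$, and $\infty$ is an eigenvalue of $P$ if $0$ is an eigenvalue of the dual pencil $sF-E$. A linear relation in $X=\mathbb C^d$ is a linear subspace $S\subseteq X\times X$. Put $N(S)=\{x:(x,0)\in S\}$, $\operatorname{mul}S=\{y:(0,y)\in S\}$, $S-\lambda=\{(x,y-\lambda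 x):(x,y)\in S\}$ for $\lambda\in\mathbb C$, and for linear relations $S,T$ put $ST=\{(x,z):(x,y)\in T\text{ and }(y,z)\in S\text{ for some }y\in X\}$; let $S^0$ be the graph of the identity and $S^{k}=S\,S^{k-1}$ for $k\ge1$. A number $\lambda\in\mathbb C$ is an eigenvalue of $S$ if $N(S-\lambda)\ne\{0\}$, and $\infty$ is an eigenvalue of $S$ if $\operatorname{mul}S\neq\{0\}$. The root manifolds are $\mathcal R_\lambda(S)=\bigcup_{k\ge0}N((S-\lambda)^k)$ for $\lambda\in\mathbb C$ and $\mathcal R_\infty(S)=\bigcup_{k\ge0}\operatorname{mul}(S^k)$, and $\mathcal R_c(S)=\mathcal R_0(S)\cap\mathcal R_\infty(S)$. An eigenvalue $\lambda\in\mathbb C\cup\{\infty\}$ of $S$ is called proper if $\mathcal R_\lambda(S)\not\subseteq\mathcal R_c(S)$. -/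

import Mathlib

noncomputable section

/-- A linear relation in the complex vector space `V`: a linear subspace of `V × V`. -/
abbrev LinRel (V : Type*) [AddCommGroup V] [Module ℂ V] := Submodule ℂ (V × V)

namespace LinRel

variable {V : Type*} [AddCommGroup V] [Module ℂ V]

/-- The kernel `N(S) = {x | (x, 0) ∈ S}`. -/
def ker (S : LinRel V) : Submodule ℂ V := S.comap (LinearMap.inl ℂ V V)

/-- The multivalued part `mul(S) = {y | (0, y) ∈ S}`. -/
def mul (S : LinRel V) : Submodule ℂ V := S.comap (LinearMap.inr ℂ V V)

/-- The relation `S - z = {(x, y - z x) | (x, y) ∈ S}`. -/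
def shift (S : LinRel V) (z : ℂ) : LinRel V :=
  S.map ((LinearMap.fst ℂ V V).prod (LinearMap.snd ℂ V V - z • LinearMap.fst ℂ V V))

/-- The product `S T = {(x, z) | (x, y) ∈ T and (y, z) ∈ S for some y}`. -/
def comp (S T : LinRel V) : LinRel V where
  carrier := {p | ∃ y : V, (p.1, y) ∈ T ∧ (y, p.2) ∈ S}
  add_mem' := by
    rintro p q ⟨y, h1, h2⟩ ⟨y', h1', h2'⟩
    exact ⟨y + y', T.add_mem h1 h1', S.add_mem h2 h2'⟩
  zero_mem' := ⟨0, T.zero_mem, S.zero_mem⟩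
  smul_mem' := by
    rintro c p ⟨y, h1, h2⟩
    exact ⟨c • y, T.smul_mem c h1, S.smul_mem c h2⟩

/-- The powers of a linear relation: `S^0 = I` is the graph of the identity,
and `S^(k+1) = S S^k`. -/
def power (S : LinRel V) : ℕ → LinRel V
  | 0 => (LinearMap.id : V →ₗ[ℂ] V).graph
  | k + 1 => S.comp (S.power k)

/-- `l ∈ ℂ ∪ {∞}` is an eigenvalue of `S`: `N(S - l) ≠ {0}` for finite `l`,
and `mul(S) ≠ {0}` for `l = ∞`. -/
def IsEigenvalue (S : LinRel V) : OnePoint ℂ → Prop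
  | OnePoint.some z => (S.shift z).ker ≠ ⊥
  | OnePoint.infty => S.mul ≠ ⊥

/-- The root manifolds `⋃ₖ N((S - l)^k)` for finite `l`, and `⋃ₖ mul(S^k)` for `l = ∞`. -/
def rootManifold (S : LinRel V) : OnePoint ℂ → Set V
  | OnePoint.some z => ⋃ k : ℕ, (((S.shift z).power k).ker : Set V)
  | OnePoint.infty => ⋃ k : ℕ, ((S.power k).mul : Set V)

/-- The singular chains subspace: the intersection of the root manifolds at `0` and at `∞`. -/
def singularChains (S : LinRel V) : Set V :=
  S.rootManifold ((0 : ℂ) : OnePoint ℂ) ∩ S.rootManifold OnePoint.infty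

/-- An eigenvalue is proper if its root manifold is not contained in the
singular chains subspace. -/
def IsProperEigenvalue (S : LinRel V) (l : OnePoint ℂ) : Prop :=
  S.IsEigenvalue l ∧ ¬ S.rootManifold l ⊆ S.singularChains

end LinRel

namespace Pencil

/-- A square pencil `s E - F` is regular if `det (s E - F)` does not vanish for all `s`. -/
def IsRegular {k : ℕ} (E F : Matrix (Fin k) (Fin k) ℂ) : Prop :=
  ∃ s : ℂ, (s • E - F).det ≠ 0

/-- The (normal) rank of the pencil `s E - F`: the largest size of a regular submatrix pencil.
The size is at most `n`, and size `0` always occurs. -/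
def normalRank {n m : ℕ} (E F : Matrix (Fin n) (Fin m) ℂ) : ℕ :=
  sSup {k : ℕ | ∃ (r : Fin k ↪o Fin n) (c : Fin k ↪o Fin m),
    IsRegular (E.submatrix r c) (F.submatrix r c)}

/-- `z ∈ ℂ` is a finite eigenvalue of `s E - F` if the rank of `z E - F` is less than
the normal rank of the pencil. -/
def IsFiniteEigenvalue {n m : ℕ} (E F : Matrix (Fin n) (Fin m) ℂ) (z : ℂ) : Prop :=
  (z • E - F).rank < normalRank E F

/-- Eigenvalues in `ℂ ∪ {∞}` of `s E - F`; the point `∞` is an eigenvalue if `0` is an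
eigenvalue of the dual pencil `s F - E`. -/
def IsEigenvalue {n m : ℕ} (E F : Matrix (Fin n) (Fin m) ℂ) : OnePoint ℂ → Prop
  | OnePoint.some z => IsFiniteEigenvalue E F z
  | OnePoint.infty => IsFiniteEigenvalue F E 0

/-- The kernel representation `E⁻¹ F = {(x, y) | F x = E y}`. -/
def kernelRep {n m : ℕ} (E F : Matrix (Fin n) (Fin m) ℂ) : LinRel (Fin m → ℂ) :=
  LinearMap.ker (F.mulVecLin.coprod (-E.mulVecLin))

/-- The range representation `F E⁻¹ = {(E x, F x) | x}`. -/
def rangeRep {n m : ℕ} (E F : Matrix (Fin n) (Fin m) ℂ) : LinRel (Fin n → ℂ) :=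
  LinearMap.range (E.mulVecLin.prod F.mulVecLin)

end Pencil

end

open Module in
/-- Rank-nullity for the restriction of a linear map to a subspace. -/
theorem LinearMap.finrank_map_add_finrank_inf_ker {K V U : Type*} [Field K]
    [AddCommGroup V] [Module K V] [FiniteDimensional K V] [AddCommGroup U] [Module K U]
    (T : V →ₗ[K] U) (W : Submodule K V) :
    finrank K (W.map T) + finrank K ↥(W ⊓ LinearMap.ker T) = finrank K W := by
  have h := (T.domRestrict W).finrank_range_add_finrank_ker
  rw [LinearMap.range_domRestrict, LinearMap.ker_domRestrict] at h
  rw [← h, (Submodule.equivSubtypeMap W ((LinearMap.ker T).comap W.subtype)).finrank_eq,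
    Submodule.map_comap_subtype]

section PencilRank

open Module

variable {V U : Type*} [AddCommGroup V] [Module ℂ V] [FiniteDimensional ℂ V]
  [AddCommGroup U] [Module ℂ U] (E F : V →ₗ[ℂ] U) (W : Submodule ℂ V)

/-- If `E⁻¹ (F W) = W`, then for all but finitely many `s` the kernel of `s E - F` is in `W`. -/
theorem finite_setOf_not_ker_smul_sub_le (hW : ∀ y, y ∈ W ↔ ∃ x ∈ W, F x = E y) :
    {s : ℂ | ¬ LinearMap.ker (s • E - F) ≤ W}.Finite := by
  have hE : W ≤ (W.map F).comap E := fun y hy => by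
    obtain ⟨x, hx, h⟩ := (hW y).1 hy
    exact ⟨x, hx, h⟩
  have hF : W ≤ (W.map F).comap F := Submodule.le_comap_map F W
  have hinj : LinearMap.ker (W.mapQ (W.map F) E hE) = ⊥ := by
    rw [LinearMap.ker_eq_bot']
    intro x
    obtain ⟨y, rfl⟩ := Submodule.mkQ_surjective W x
    intro h
    simp only [Submodule.mkQ_apply, Submodule.mapQ_apply, Submodule.Quotient.mk_eq_zero] at h ⊢
    obtain ⟨x, hx, h⟩ := h
    exact (hW y).2 ⟨x, hx, h⟩
  obtain ⟨L, hL⟩ := LinearMap.exists_leftInverse_of_injective _ hinj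
  refine (Module.End.finite_hasEigenvalue (L ∘ₗ W.mapQ (W.map F) F hF)).subset ?_
  intro s hs
  obtain ⟨x, hx, hxW⟩ := SetLike.not_le_iff_exists.1 hs
  refine Module.End.hasEigenvalue_of_hasEigenvector (x := W.mkQ x) ⟨?_, by simpa using hxW⟩
  have hx' : F x = s • E x := by
    rw [LinearMap.mem_ker, LinearMap.sub_apply, sub_eq_zero] at hx
    exact hx.symm
  have h2 := LinearMap.congr_fun hL (W.mkQ x)
  rw [Module.End.mem_eigenspace_iff]
  simp only [LinearMap.comp_apply, Submodule.mkQ_apply, Submodule.mapQ_apply,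
    LinearMap.id_apply] at h2 ⊢
  rw [hx', Submodule.Quotient.mk_smul, map_smul, h2]

/-- If `E W ⊆ F W`, then `(s E - F) W = F W` for all but finitely many `s`. -/
theorem finite_setOf_map_smul_sub_ne (hW : W.map E ≤ W.map F) :
    {s : ℂ | W.map (s • E - F) ≠ W.map F}.Finite := by
  let f : W →ₗ[ℂ] W.map F := F.restrict fun x hx => Submodule.mem_map_of_mem hx
  let g : W →ₗ[ℂ] W.map F := E.restrict fun x hx => hW (Submodule.mem_map_of_mem hx)
  have hf : LinearMap.range f = ⊤ := by
    rw [LinearMap.range_eq_top]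
    rintro ⟨_, x, hx, rfl⟩
    exact ⟨⟨x, hx⟩, rfl⟩
  obtain ⟨R, hR⟩ := f.exists_rightInverse_of_surjective hf
  refine ((Module.End.finite_hasEigenvalue (g ∘ₗ R)).preimage
    inv_injective.injOn).subset fun s hs => ?_
  by_contra hev
  apply hs
  have hinj : Function.Injective (s • (g ∘ₗ R) - LinearMap.id : End ℂ (W.map F)) := by
    rw [← LinearMap.ker_eq_bot, LinearMap.ker_eq_bot']
    intro u hu
    by_contra hu0
    have hu' : s • g (R u) = u := by simpa [sub_eq_zero] using hu
    have hs0 : s ≠ 0 := by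
      rintro rfl
      exact hu0 (by simpa using hu'.symm)
    refine hev (Module.End.hasEigenvalue_of_hasEigenvector (x := u) ⟨?_, hu0⟩)
    rw [Module.End.mem_eigenspace_iff, LinearMap.comp_apply]
    nth_rw 2 [← hu']
    rw [inv_smul_smul₀ hs0]
  apply le_antisymm
  · rintro _ ⟨x, hx, rfl⟩
    exact sub_mem (Submodule.smul_mem _ _ (hW (Submodule.mem_map_of_mem hx)))
      (Submodule.mem_map_of_mem hx)
  · intro u hu
    obtain ⟨v, hv⟩ := LinearMap.surjective_of_injective hinj ⟨u, hu⟩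
    refine ⟨R v, (R v).2, ?_⟩
    have h1 := LinearMap.congr_fun hR v
    have h2 : s • g (R v) - f (R v) = ⟨u, hu⟩ := by
      rw [← hv]
      simpa using h1
    exact congrArg Subtype.val h2

/-- The rank of `s E - F` exceeds the rank of `F` for some `s` if and only if the kernel
of `F` is not contained in a subspace `W` with `E⁻¹ (F W) = W`. -/
theorem exists_finrank_range_lt_iff (hW : ∀ y, y ∈ W ↔ ∃ x ∈ W, F x = E y) :
    (∃ s : ℂ, finrank ℂ (LinearMap.range F) < finrank ℂ (LinearMap.range (s • E - F))) ↔
      ¬ LinearMap.ker F ≤ W := by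
  have hE : W.map E ≤ W.map F := by
    rintro _ ⟨y, hy, rfl⟩
    obtain ⟨x, hx, h⟩ := (hW y).1 hy
    exact ⟨x, hx, h⟩
  have hFW := F.finrank_map_add_finrank_inf_ker W
  have hF := F.finrank_range_add_finrank_ker
  constructor
  · rintro ⟨s, hs⟩ hker
    have hsW := (s • E - F).finrank_map_add_finrank_inf_ker W
    have hsr := (s • E - F).finrank_range_add_finrank_ker
    have h1 : finrank ℂ (W.map (s • E - F)) ≤ finrank ℂ (W.map F) := by
      apply Submodule.finrank_mono
      rintro _ ⟨x, hx, rfl⟩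
      exact sub_mem (Submodule.smul_mem _ _ (hE (Submodule.mem_map_of_mem hx)))
        (Submodule.mem_map_of_mem hx)
    have h2 : finrank ℂ ↥(W ⊓ LinearMap.ker (s • E - F)) ≤
        finrank ℂ (LinearMap.ker (s • E - F)) := Submodule.finrank_mono inf_le_right
    rw [inf_eq_right.2 hker] at hFW
    omega
  · intro hker
    obtain ⟨s, hs⟩ := ((finite_setOf_not_ker_smul_sub_le E F W hW).union
      (finite_setOf_map_smul_sub_ne E F W hE)).infinite_compl.nonempty
    simp only [Set.mem_compl_iff, Set.mem_union, Set.mem_ofPred_eq, not_or, not_not] at hs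
    refine ⟨s, ?_⟩
    have hsW := (s • E - F).finrank_map_add_finrank_inf_ker W
    have hsr := (s • E - F).finrank_range_add_finrank_ker
    rw [inf_eq_right.2 hs.1, hs.2] at hsW
    have h3 : finrank ℂ ↥(W ⊓ LinearMap.ker F) < finrank ℂ (LinearMap.ker F) :=
      Submodule.finrank_lt_finrank_of_lt
        (lt_of_le_of_ne inf_le_right fun h => hker (inf_eq_right.1 h))
    omega

end PencilRank

/-- A matrix has a nonsingular square submatrix of the size of its rank. -/
theorem Matrix.exists_submatrix_det_ne_zero {K : Type*} [Field K] {n m : ℕ}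
    (A : Matrix (Fin n) (Fin m) K) :
    ∃ (r : Fin A.rank ↪o Fin n) (c : Fin A.rank ↪o Fin m), (A.submatrix r c).det ≠ 0 := by
  have key : ∀ {p q k : ℕ} (B : Matrix (Fin p) (Fin q) K), B.rank = k →
      ∃ r : Fin k ↪o Fin p, (B.submatrix r id).rank = k := by
    intro p q k B hB
    obtain ⟨κ, a, ha, hsp, hli⟩ := exists_linearIndependent' K B.row
    have : Fintype κ := Fintype.ofInjective a ha
    have hcard : (Finset.univ.image a).card = k := by
      rw [Finset.card_image_of_injective _ ha, Finset.card_univ, ← hB,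
        Matrix.rank_eq_finrank_span_row, ← hsp, finrank_span_eq_card hli]
    refine ⟨(Finset.univ.image a).orderEmbOfFin hcard, ?_⟩
    rw [Matrix.rank_eq_finrank_span_row]
    have hr : Set.range ((Finset.univ.image a).orderEmbOfFin hcard) = Set.range a := by
      rw [Finset.range_orderEmbOfFin]
      simp
    have : Set.range (B.submatrix ((Finset.univ.image a).orderEmbOfFin hcard) id).row =
        Set.range (B.row ∘ a) := by
      rw [Set.range_comp, ← hr, ← Set.range_comp]
      rfl
    rw [this, hsp, ← Matrix.rank_eq_finrank_span_row, hB]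
  obtain ⟨r, hr⟩ := key A rfl
  obtain ⟨c, hc⟩ := key (A.submatrix r id).transpose ((Matrix.rank_transpose _).trans hr)
  refine ⟨r, c, fun hdet => ?_⟩
  have hdet' : (((A.submatrix r id).transpose.submatrix c id)).det = 0 := by
    rw [← hdet, ← Matrix.det_transpose]
    rfl
  obtain ⟨v, hv, h⟩ := Matrix.exists_mulVec_eq_zero_iff.2 hdet'
  have h1 := ((A.submatrix r id).transpose.submatrix c id).mulVecLin.finrank_range_add_finrank_ker
  rw [← Matrix.rank, hc, Module.finrank_fin_fun, Nat.add_eq_left, Submodule.finrank_eq_zero] at h1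
  have : v ∈ (⊥ : Submodule K _) := h1 ▸ h
  exact hv (by simpa using this)

namespace Pencil

theorem lt_normalRank_iff {n m : ℕ} (E F : Matrix (Fin n) (Fin m) ℂ) (k : ℕ) :
    k < normalRank E F ↔ ∃ s : ℂ, k < (s • E - F).rank := by
  have hne : {k : ℕ | ∃ (r : Fin k ↪o Fin n) (c : Fin k ↪o Fin m),
      IsRegular (E.submatrix r c) (F.submatrix r c)}.Nonempty :=
    ⟨0, Fin.castLEOrderEmb (Nat.zero_le _), Fin.castLEOrderEmb (Nat.zero_le _), 0, by simp⟩
  have hbdd : BddAbove {k : ℕ | ∃ (r : Fin k ↪o Fin n) (c : Fin k ↪o Fin m),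
      IsRegular (E.submatrix r c) (F.submatrix r c)} := by
    refine ⟨n, ?_⟩
    rintro k ⟨r, -⟩
    simpa using Fintype.card_le_of_embedding r.toEmbedding
  rw [normalRank, lt_csSup_iff hbdd hne]
  constructor
  · rintro ⟨j, ⟨r, c, s, hs⟩, hk⟩
    refine ⟨s, hk.trans_le ?_⟩
    have h : (s • E - F).submatrix r c = s • E.submatrix r c - F.submatrix r c := rfl
    rw [← h] at hs
    simpa [Matrix.rank_of_det_ne_zero hs] using (s • E - F).rank_submatrix_le r c
  · rintro ⟨s, hs⟩
    obtain ⟨r, c, h⟩ := (s • E - F).exists_submatrix_det_ne_zero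
    exact ⟨_, ⟨r, c, s, h⟩, hs⟩

end Pencil

namespace LinRel

variable {V : Type*} [AddCommGroup V] [Module ℂ V]

theorem mem_ker_iff {S : LinRel V} {x : V} : x ∈ S.ker ↔ (x, 0) ∈ S := Iff.rfl

theorem mem_shift_iff {S : LinRel V} {z : ℂ} {x y : V} :
    (x, y) ∈ S.shift z ↔ (x, y + z • x) ∈ S := by
  constructor
  · rintro ⟨⟨a, b⟩, h, he⟩
    obtain ⟨rfl, rfl⟩ : a = x ∧ b - z • a = y := Prod.mk.inj he
    simpa using h
  · intro h
    exact ⟨_, h, by simp⟩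

theorem shift_zero (S : LinRel V) : S.shift 0 = S := by
  ext ⟨x, y⟩
  simp [mem_shift_iff]

theorem shift_shift_neg (S : LinRel V) (z : ℂ) : (S.shift z).shift (-z) = S := by
  ext ⟨x, y⟩
  simp [mem_shift_iff]

theorem mem_power_zero_iff {S : LinRel V} {x y : V} : (x, y) ∈ S.power 0 ↔ y = x := by
  simp [power, LinearMap.mem_graph_iff]

theorem mem_power_succ_iff {S : LinRel V} {k : ℕ} {x z : V} :
    (x, z) ∈ S.power (k + 1) ↔ ∃ y, (x, y) ∈ S.power k ∧ (y, z) ∈ S := Iff.rfl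

theorem mem_power_succ_iff' {S : LinRel V} {k : ℕ} {x z : V} :
    (x, z) ∈ S.power (k + 1) ↔ ∃ y, (x, y) ∈ S ∧ (y, z) ∈ S.power k := by
  induction k generalizing z with
  | zero => simp [mem_power_succ_iff, mem_power_zero_iff]
  | succ k ih =>
    rw [mem_power_succ_iff]
    simp only [ih]
    constructor
    · rintro ⟨y, ⟨w, h1, h2⟩, h3⟩
      exact ⟨w, h1, y, h2, h3⟩
    · rintro ⟨w, h1, y, h2, h3⟩
      exact ⟨y, ⟨w, h1, h2⟩, h3⟩

theorem mem_mul_power_zero_iff {S : LinRel V} {y : V} : y ∈ (S.power 0).mul ↔ y = 0 :=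
  mem_power_zero_iff (S := S)

theorem mem_ker_power_zero_iff {S : LinRel V} {y : V} : y ∈ (S.power 0).ker ↔ y = 0 :=
  (mem_power_zero_iff (S := S)).trans eq_comm

theorem mem_mul_power_succ_iff {S : LinRel V} {k : ℕ} {y : V} :
    y ∈ (S.power (k + 1)).mul ↔ ∃ x ∈ (S.power k).mul, (x, y) ∈ S := Iff.rfl

theorem mem_ker_power_succ_iff {S : LinRel V} {k : ℕ} {x : V} :
    x ∈ (S.power (k + 1)).ker ↔ ∃ y ∈ (S.power k).ker, (x, y) ∈ S :=
  mem_power_succ_iff'.trans (exists_congr fun _ => and_comm)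

theorem mul_power_mono (S : LinRel V) : Monotone fun k => (S.power k).mul := by
  refine monotone_nat_of_le_succ fun k => ?_
  induction k with
  | zero =>
    intro y hy
    rw [mem_mul_power_zero_iff.1 hy]
    exact zero_mem _
  | succ k ih =>
    intro y hy
    obtain ⟨x, hx, h⟩ := mem_mul_power_succ_iff.1 hy
    exact mem_mul_power_succ_iff.2 ⟨x, ih hx, h⟩

theorem mul_power_mono_left {S T : LinRel V} (h : S ≤ T) (k : ℕ) :
    (S.power k).mul ≤ (T.power k).mul := by
  induction k with
  | zero => exact le_rfl
  | succ k ih =>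
    rintro y ⟨x, hx, hxy⟩
    exact mem_mul_power_succ_iff.2 ⟨x, ih hx, h hxy⟩

theorem mul_power_le_mul_power_shift (S : LinRel V) (z : ℂ) (k : ℕ) :
    (S.power k).mul ≤ ((S.shift z).power k).mul := by
  induction k with
  | zero => exact le_rfl
  | succ k ih =>
    rintro y ⟨x, hx, hxy⟩
    have h1 : y - z • x ∈ ((S.shift z).power (k + 1)).mul :=
      mem_mul_power_succ_iff.2 ⟨x, ih hx, mem_shift_iff.2 (by simpa using hxy)⟩
    have h2 : z • x ∈ ((S.shift z).power (k + 1)).mul :=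
      Submodule.smul_mem _ _ (mul_power_mono _ k.le_succ (ih hx))
    simpa using add_mem h1 h2

theorem mul_power_shift (S : LinRel V) (z : ℂ) (k : ℕ) :
    ((S.shift z).power k).mul = (S.power k).mul := by
  refine le_antisymm ?_ (mul_power_le_mul_power_shift S z k)
  simpa only [shift_shift_neg] using mul_power_le_mul_power_shift (S.shift z) (-z) k

/-- The inverse relation. -/
def inverse (S : LinRel V) : LinRel V :=
  S.comap ((LinearMap.snd ℂ V V).prod (LinearMap.fst ℂ V V))

theorem mem_inverse_iff {S : LinRel V} {x y : V} : (x, y) ∈ S.inverse ↔ (y, x) ∈ S := Iff.rfl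

theorem inverse_inverse (S : LinRel V) : S.inverse.inverse = S := rfl

theorem ker_power_inverse (S : LinRel V) (k : ℕ) : (S.inverse.power k).ker = (S.power k).mul := by
  induction k with
  | zero =>
    ext y
    rw [mem_ker_power_zero_iff, mem_mul_power_zero_iff]
  | succ k ih =>
    ext y
    rw [mem_ker_power_succ_iff, mem_mul_power_succ_iff, ih]
    rfl

/-- The root manifold at `∞` as a subspace. -/
def rootInfty (S : LinRel V) : Submodule ℂ V := ⨆ k, (S.power k).mul

theorem mem_rootInfty_iff {S : LinRel V} {y : V} :
    y ∈ S.rootInfty ↔ ∃ k, y ∈ (S.power k).mul :=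
  Submodule.mem_iSup_of_directed _ (mul_power_mono S).directed_le

theorem rootManifold_infty (S : LinRel V) :
    S.rootManifold OnePoint.infty = S.rootInfty := by
  ext y
  rw [SetLike.mem_coe, mem_rootInfty_iff]
  exact Set.mem_iUnion

theorem rootManifold_coe (S : LinRel V) (z : ℂ) :
    S.rootManifold (z : OnePoint ℂ) = (S.shift z).inverse.rootInfty := by
  ext y
  rw [SetLike.mem_coe, mem_rootInfty_iff]
  simp_rw [← ker_power_inverse, inverse_inverse]
  exact Set.mem_iUnion

theorem rootInfty_shift (S : LinRel V) (z : ℂ) : (S.shift z).rootInfty = S.rootInfty := by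
  simp_rw [rootInfty, mul_power_shift]

theorem rootInfty_mono {S T : LinRel V} (h : S ≤ T) : S.rootInfty ≤ T.rootInfty :=
  iSup_mono (mul_power_mono_left h)

theorem mem_rootInfty_iff_exists {S : LinRel V} {y : V} :
    y ∈ S.rootInfty ↔ ∃ x ∈ S.rootInfty, (x, y) ∈ S := by
  constructor
  · intro hy
    obtain ⟨k, hk⟩ := mem_rootInfty_iff.1 hy
    obtain ⟨x, hx, h⟩ := mem_mul_power_succ_iff.1 (mul_power_mono S k.le_succ hk)
    exact ⟨x, mem_rootInfty_iff.2 ⟨k, hx⟩, h⟩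
  · rintro ⟨x, hx, h⟩
    obtain ⟨k, hk⟩ := mem_rootInfty_iff.1 hx
    exact mem_rootInfty_iff.2 ⟨k + 1, x, hk, h⟩

theorem rootInfty_inverse_le_of_ker_le {T : LinRel V} (h : T.ker ≤ T.rootInfty) :
    T.inverse.rootInfty ≤ T.rootInfty := by
  refine iSup_le fun k => ?_
  induction k with
  | zero =>
    intro x hx
    rw [mem_mul_power_zero_iff.1 hx]
    exact zero_mem _
  | succ k ih =>
    intro x hx
    obtain ⟨y, hy, hxy⟩ := mem_mul_power_succ_iff.1 hx
    obtain ⟨x', hx', hx'y⟩ := mem_rootInfty_iff_exists.1 (ih hy)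
    have hsub : x - x' ∈ T.ker := by
      have h1 := T.sub_mem (mem_inverse_iff.1 hxy) hx'y
      rwa [Prod.mk_sub_mk, sub_self] at h1
    simpa using add_mem (h hsub) hx'

/-- If every element of a subspace `C` has a successor in `C`, and is reached from `0` by a chain
in `C`, then every element of `C` is the start of a chain that ends in `0`. -/
theorem le_rootInfty_inverse [FiniteDimensional ℂ V] {S : LinRel V} {C : Submodule ℂ V}
    (hC : C ≤ S.rootInfty) (hsucc : ∀ v ∈ C, ∃ w ∈ C, (v, w) ∈ S) :
    C ≤ S.inverse.rootInfty := by
  obtain ⟨K, hK⟩ := monotone_stabilizes_iff_noetherian.2 (inferInstance : IsNoetherian ℂ V)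
    ⟨_, mul_power_mono S⟩
  have hCK : C ≤ (S.power K).mul := by
    intro v hv
    obtain ⟨k, hk⟩ := mem_rootInfty_iff.1 (hC hv)
    have h1 := mul_power_mono S (le_max_left k K) hk
    have h2 : (S.power K).mul = (S.power (max k K)).mul := hK _ (le_max_right k K)
    rwa [h2]
  have hchain : ∀ k, ∀ v ∈ C, ∃ w ∈ C, (v, w) ∈ S.power k := by
    intro k
    induction k with
    | zero => exact fun v hv => ⟨v, hv, mem_power_zero_iff.2 rfl⟩
    | succ k ih =>
      intro v hv
      obtain ⟨w, hw, h⟩ := ih v hv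
      obtain ⟨u, hu, h'⟩ := hsucc w hw
      exact ⟨u, hu, w, h, h'⟩
  intro v hv
  obtain ⟨w, hw, h⟩ := hchain K v hv
  refine mem_rootInfty_iff.2 ⟨K, ?_⟩
  rw [← ker_power_inverse, inverse_inverse, mem_ker_iff]
  simpa using sub_mem h (hCK hw)

theorem rootInfty_inf_rootInfty_inverse_shift_le [FiniteDimensional ℂ V] (S : LinRel V) (z : ℂ) :
    (S.shift z).inverse.rootInfty ⊓ S.rootInfty ≤ S.inverse.rootInfty := by
  rw [← rootInfty_shift S z]
  set T := S.shift z with hT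
  set C := T.inverse.rootInfty ⊓ T.rootInfty with hCdef
  have hS : S = T.shift (-z) := (shift_shift_neg S z).symm
  let T' : LinRel V := T ⊓ C.prod C
  have hC : C ≤ T'.rootInfty := by
    rintro v ⟨hv1, hv2⟩
    obtain ⟨k, hk⟩ := mem_rootInfty_iff.1 hv2
    refine mem_rootInfty_iff.2 ⟨k, ?_⟩
    clear hv2
    induction k generalizing v with
    | zero => exact hk
    | succ k ih =>
      have hv2 : v ∈ T.rootInfty := mem_rootInfty_iff.2 ⟨_, hk⟩
      obtain ⟨u, hu, huv⟩ := mem_mul_power_succ_iff.1 hk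
      have hu1 : u ∈ T.inverse.rootInfty := mem_rootInfty_iff_exists.2 ⟨v, hv1, huv⟩
      exact ⟨u, ih hu1 hu, huv, ⟨hu1, mem_rootInfty_iff.2 ⟨k, hu⟩⟩, hv1, hv2⟩
  have hle : T'.shift (-z) ≤ S := by
    rw [hS]
    exact Submodule.map_mono inf_le_left
  rw [← rootInfty_shift T' (-z)] at hC
  refine le_rootInfty_inverse (hC.trans (rootInfty_mono hle)) ?_
  rintro v ⟨hv1, hv2⟩
  obtain ⟨w, hw, hvw⟩ := mem_rootInfty_iff_exists.1 hv1
  have hwC : w ∈ C := ⟨hw, mem_rootInfty_iff_exists.2 ⟨v, hv2, hvw⟩⟩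
  refine ⟨w + z • v, add_mem hwC (Submodule.smul_mem _ _ ⟨hv1, hv2⟩), ?_⟩
  exact mem_shift_iff.1 hvw

theorem singularChains_eq (S : LinRel V) :
    S.singularChains = S.inverse.rootInfty ⊓ S.rootInfty := by
  rw [singularChains, rootManifold_coe, rootManifold_infty, shift_zero, Submodule.coe_inf]

theorem isProperEigenvalue_coe_iff [FiniteDimensional ℂ V] (S : LinRel V) (z : ℂ) :
    S.IsProperEigenvalue (z : OnePoint ℂ) ↔ ¬ (S.shift z).ker ≤ S.rootInfty := by
  rw [IsProperEigenvalue, rootManifold_coe, singularChains_eq, SetLike.coe_subset_coe]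
  constructor
  · rintro ⟨-, h⟩ hker
    rw [← rootInfty_shift S z] at hker
    have h1 := rootInfty_inverse_le_of_ker_le hker
    rw [rootInfty_shift] at h1
    exact h (le_inf ((le_inf le_rfl h1).trans (S.rootInfty_inf_rootInfty_inverse_shift_le z)) h1)
  · intro h
    refine ⟨fun h0 => h ?_, fun h0 => h ?_⟩
    · rw [h0]
      exact bot_le
    · refine le_trans (fun x hx => ?_) (h0.trans inf_le_right)
      exact mem_rootInfty_iff_exists.2 ⟨0, zero_mem _, hx⟩

theorem isProperEigenvalue_infty_iff (S : LinRel V) :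
    S.IsProperEigenvalue OnePoint.infty ↔
      S.inverse.IsProperEigenvalue ((0 : ℂ) : OnePoint ℂ) := by
  have h : S.inverse.IsEigenvalue ((0 : ℂ) : OnePoint ℂ) ↔ S.mul ≠ ⊥ := by
    change (S.inverse.shift 0).ker ≠ ⊥ ↔ _
    rw [shift_zero]
    rfl
  rw [IsProperEigenvalue, IsProperEigenvalue, rootManifold_coe, rootManifold_infty,
    singularChains_eq, singularChains_eq, shift_zero, inverse_inverse, h, inf_comm]
  rfl

end LinRel

namespace Pencil

variable {n m : ℕ} (E F : Matrix (Fin n) (Fin m) ℂ)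

open Matrix

theorem mem_kernelRep_iff {x y : Fin m → ℂ} : (x, y) ∈ kernelRep E F ↔ F *ᵥ x = E *ᵥ y := by
  simp [kernelRep, ← sub_eq_add_neg, sub_eq_zero]

theorem mem_rangeRep_iff {x y : Fin n → ℂ} :
    (x, y) ∈ rangeRep E F ↔ ∃ u, E *ᵥ u = x ∧ F *ᵥ u = y := by
  simp [rangeRep]

theorem kernelRep_inverse : (kernelRep E F).inverse = kernelRep F E := by
  ext ⟨x, y⟩
  rw [LinRel.mem_inverse_iff, mem_kernelRep_iff, mem_kernelRep_iff, eq_comm]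

theorem rangeRep_inverse : (rangeRep E F).inverse = rangeRep F E := by
  ext ⟨x, y⟩
  simp only [LinRel.mem_inverse_iff, mem_rangeRep_iff, and_comm]

theorem mem_kernelRep_shift_iff {z : ℂ} {x y : Fin m → ℂ} :
    (x, y) ∈ (kernelRep E F).shift z ↔ (F - z • E) *ᵥ x = E *ᵥ y := by
  rw [LinRel.mem_shift_iff, mem_kernelRep_iff, sub_mulVec, smul_mulVec, mulVec_add, mulVec_smul,
    sub_eq_iff_eq_add]

theorem mem_mul_power_rangeRep_iff {k : ℕ} {y : Fin n → ℂ} :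
    y ∈ ((rangeRep E F).power k).mul ↔ ∃ x ∈ ((kernelRep E F).power k).mul, F *ᵥ x = y := by
  induction k generalizing y with
  | zero => simp [LinRel.mem_mul_power_zero_iff, eq_comm]
  | succ k ih =>
    simp only [LinRel.mem_mul_power_succ_iff, ih, mem_rangeRep_iff, mem_kernelRep_iff]
    constructor
    · rintro ⟨_, ⟨u, hu, rfl⟩, x, h, rfl⟩
      exact ⟨x, ⟨u, hu, h.symm⟩, rfl⟩
    · rintro ⟨x, ⟨u, hu, h⟩, rfl⟩
      exact ⟨_, ⟨u, hu, rfl⟩, x, h.symm, rfl⟩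

theorem mem_rootInfty_rangeRep_iff {y : Fin n → ℂ} :
    y ∈ (rangeRep E F).rootInfty ↔ ∃ x ∈ (kernelRep E F).rootInfty, F *ᵥ x = y := by
  simp only [LinRel.mem_rootInfty_iff, mem_mul_power_rangeRep_iff]
  exact ⟨fun ⟨k, x, hx, h⟩ => ⟨x, ⟨k, hx⟩, h⟩, fun ⟨x, ⟨k, hx⟩, h⟩ => ⟨k, x, hx, h⟩⟩

theorem mulVec_mem_rootInfty_rangeRep_iff {x : Fin m → ℂ} :
    E *ᵥ x ∈ (rangeRep E F).rootInfty ↔ x ∈ (kernelRep E F).rootInfty := by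
  rw [mem_rootInfty_rangeRep_iff, LinRel.mem_rootInfty_iff_exists (y := x)]
  simp only [mem_kernelRep_iff]

theorem isProperEigenvalue_kernelRep_iff_rangeRep (z : ℂ) :
    (kernelRep E F).IsProperEigenvalue (z : OnePoint ℂ) ↔
      (rangeRep E F).IsProperEigenvalue (z : OnePoint ℂ) := by
  rw [LinRel.isProperEigenvalue_coe_iff, LinRel.isProperEigenvalue_coe_iff, not_iff_not]
  constructor
  · intro h y hy
    rw [LinRel.mem_ker_iff, LinRel.mem_shift_iff, mem_rangeRep_iff] at hy
    obtain ⟨u, rfl, hu⟩ := hy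
    rw [mulVec_mem_rootInfty_rangeRep_iff]
    apply h
    rw [LinRel.mem_ker_iff, LinRel.mem_shift_iff, mem_kernelRep_iff, hu, zero_add, zero_add,
      mulVec_smul]
  · intro h x hx
    rw [LinRel.mem_ker_iff, LinRel.mem_shift_iff, mem_kernelRep_iff] at hx
    rw [← mulVec_mem_rootInfty_rangeRep_iff]
    apply h
    rw [LinRel.mem_ker_iff, LinRel.mem_shift_iff, mem_rangeRep_iff]
    exact ⟨x, rfl, by rw [hx, zero_add, zero_add, mulVec_smul]⟩

theorem isFiniteEigenvalue_iff (z : ℂ) :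
    IsFiniteEigenvalue E F z ↔ (kernelRep E F).IsProperEigenvalue (z : OnePoint ℂ) := by
  rw [IsFiniteEigenvalue, lt_normalRank_iff, LinRel.isProperEigenvalue_coe_iff]
  have hker : ((kernelRep E F).shift z).ker = LinearMap.ker (F - z • E).mulVecLin := by
    ext x
    rw [LinRel.mem_ker_iff, mem_kernelRep_shift_iff, mulVec_zero]
    rfl
  have hneg : (z • E - F).rank = (F - z • E).rank := by
    have h : (z • E - F).mulVecLin = -(F - z • E).mulVecLin := by
      rw [← neg_sub F]
      ext1 x
      simp
    rw [Matrix.rank, Matrix.rank, h, LinearMap.range_neg]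
  rw [hker, hneg, ← exists_finrank_range_lt_iff E.mulVecLin (F - z • E).mulVecLin _ ?_]
  · have h : ∀ s : ℂ, s • E.mulVecLin - (F - z • E).mulVecLin = ((s + z) • E - F).mulVecLin := by
      intro s
      refine LinearMap.ext fun x => ?_
      simp only [LinearMap.sub_apply, LinearMap.smul_apply,
        mulVecLin_apply, sub_mulVec, smul_mulVec, add_smul, add_mulVec]
      abel
    refine ((Equiv.addRight z).surjective.exists
      (p := fun s => (F - z • E).rank < (s • E - F).rank)).trans (exists_congr fun s => ?_)
    rw [h s]
    rfl
  · intro y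
    rw [← LinRel.rootInfty_shift _ z, LinRel.mem_rootInfty_iff_exists]
    simp only [mem_kernelRep_shift_iff]
    rfl

end Pencil

theorem mainTheorem9 {n m : ℕ} (E F : Matrix (Fin n) (Fin m) ℂ) (l : OnePoint ℂ) :
    [Pencil.IsEigenvalue E F l,
      (Pencil.kernelRep E F).IsProperEigenvalue l,
      (Pencil.rangeRep E F).IsProperEigenvalue l].TFAE := by
  have h : (Pencil.IsEigenvalue E F l ↔ (Pencil.kernelRep E F).IsProperEigenvalue l) ∧
      ((Pencil.kernelRep E F).IsProperEigenvalue l ↔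
        (Pencil.rangeRep E F).IsProperEigenvalue l) := by
    induction l using OnePoint.rec with
    | infty =>
      rw [LinRel.isProperEigenvalue_infty_iff, LinRel.isProperEigenvalue_infty_iff,
        Pencil.kernelRep_inverse, Pencil.rangeRep_inverse]
      exact ⟨Pencil.isFiniteEigenvalue_iff F E 0,
        Pencil.isProperEigenvalue_kernelRep_iff_rangeRep F E 0⟩
    | coe z =>
      exact ⟨Pencil.isFiniteEigenvalue_iff E F z,
        Pencil.isProperEigenvalue_kernelRep_iff_rangeRep E F z⟩
  tfae_have 1 ↔ 2 := h.1
  tfae_have 2 ↔ 3 := h.2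
  tfae_finish
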